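/- Fix $n\ge 1$. \emph{The generic Kripke model.} Put $K_n^{-1}=\emptyset$. For $d\ge 0$ obtain $K_n^d$ from $K_n^{d-1}$ by adding all formal points $w_{\beta,Y}$ such that: $Y$ is a decreasing subset of $K_n^{d-1}$ and, if $d\ge 1$, $Y\not\subseteq K_n^{d-2}$; $\beta\subseteq\{P_1,\dots,P_n\}$ is contained in $\mathrm{val}(w')$ for every $w'\in Y$; and if $Y$ is the decreasing set generated by a single point $w'$, then $\beta\ne\mathrm{val}(w')$. Put $\mathrm{val}(w_{\beta,Y})=\beta$ and let $w\le w_{\beta,Y}$ iff $w\in Y$ or $w=w_{\beta,Y}$. Let $\mathfrak K_n=(K_n,\le,\mathrm{val})$ with $K_n=\bigcup_d K_n^d$. Validity $w\models\varphi$ of intuitionistic formulae is defined as usual, where $w\models\varphi\to\chi$ iff $v\models\varphi$ implies $v\models\chi$ for all $v\le w$; put $[\![\varphi]\!]=\{w\in K_n: w\models\varphi\}$. \emph{The algebras.} Let $F_n$ be the free Heyting algebra on $n$ generators, that is, the algebra of intuitionistic propositional formulae in $P_1,\dots,P_n$ modulo provable equivalence, with free generators $g_j=[P_j]$. Let $\widehat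 F_n$ be the Heyting algebra of all decreasing subsets of $K_n$, with the metric $\mathrm d(a,b)=2^{-\min\{i\ge 0\,:\,a\cap K_n^i\ne b\cap K_n^i\}}$ (and $\mathrm d(a,a)=0$). \emph{The spectrum.} For a Heyting algebra $H$ let $\mathrm{Spec}^0_\downarrow(H)$, the principal ideal spectrum, be the set of the prime ideals of $H$ that are generated by a single element $x\neq 1$, ordered by inclusion and endowed with the trace of the Zariski topology on the prime ideals, which has the basis of open sets $\{\mathfrak i : a\notin\mathfrak i\}$, $a\in H$. Put $\bar I_0(a)=\{\mathfrak i\in\mathrm{Spec}^0_\downarrow(H) : a\notin\mathfrak i\}$. \emph{Theorem.} (1) If $H$ is a Heyting sub-algebra of $\widehat F_n$ that is dense in the metric topology, then the open sets of $\mathrm{Spec}^0_\downarrow(H)$ are exactly the subsets that are decreasing with respect to inclusion. The same holds for $H=F_n$ and for $H=\widehat F_n$. (2) As a partial order, $(K_n,\le)$ is isomorphic to $\mathrm{Spec}^0_\downarrow(F_n)$ and to $\mathrm{Spec}^0_\downarrow(\widehat F_n)$, ordered by inclusion. There are natural isomorphisms, given by $w\mapsto\{[\varphi]\in F_n : w\notin[\![\varphi]\!]\}$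 and $w\mapsto\{X\in\widehat F_n : w\notin X\}$ respectively. (3) Under these isomorphisms the valuation is recovered as follows. If $w$ corresponds to $\mathfrak i\in\mathrm{Spec}^0_\downarrow(F_n)$, then $P_j\in\mathrm{val}(w)$ iff $g_j\notin\mathfrak i$, equivalently iff $\mathfrak i\in\bar I_0(g_j)$. If $w$ corresponds to $\mathfrak i\in\mathrm{Spec}^0_\downarrow(\widehat F_n)$, the same holds with $[\![P_j]\!]$, the image of $g_j$ in $\widehat F_n$, in place of $g_j$. -/

import Mathlib

namespace Bellissima

/-! ### Intuitionistic propositional logic in `n` variables and the free Heyting algebra -/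

/-- Intuitionistic propositional formulae in the variables `P_j`, `j : Fin n`. -/
inductive Formula (n : ℕ) : Type
  | var : Fin n → Formula n
  | bot : Formula n
  | and : Formula n → Formula n → Formula n
  | or : Formula n → Formula n → Formula n
  | imp : Formula n → Formula n → Formula n

/-- Natural deduction for the intuitionistic propositional calculus. -/
inductive Derives {n : ℕ} : Set (Formula n) → Formula n → Prop
  | ax {Γ φ} : φ ∈ Γ → Derives Γ φ
  | botE {Γ φ} : Derives Γ .bot → Derives Γ φ
  | andI {Γ φ ψ} : Derives Γ φ → Derives Γ ψ → Derives Γ (.and φ ψ)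
  | andE₁ {Γ φ ψ} : Derives Γ (.and φ ψ) → Derives Γ φ
  | andE₂ {Γ φ ψ} : Derives Γ (.and φ ψ) → Derives Γ ψ
  | orI₁ {Γ φ ψ} : Derives Γ φ → Derives Γ (.or φ ψ)
  | orI₂ {Γ φ ψ} : Derives Γ ψ → Derives Γ (.or φ ψ)
  | orE {Γ φ ψ χ} : Derives Γ (.or φ ψ) → Derives (insert φ Γ) χ →
      Derives (insert ψ Γ) χ → Derives Γ χ
  | impI {Γ φ ψ} : Derives (insert φ Γ) ψ → Derives Γ (.imp φ ψ)
  | impE {Γ φ ψ} : Derives Γ (.imp φ ψ) → Derives Γ φ → Derives Γ ψ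

theorem Derives.mono {n : ℕ} {Γ : Set (Formula n)} {φ : Formula n} (h : Derives Γ φ) :
    ∀ {Δ : Set (Formula n)}, Γ ⊆ Δ → Derives Δ φ := by
  induction h with
  | ax h => exact fun s => .ax (s h)
  | botE _ ih => exact fun s => .botE (ih s)
  | andI _ _ ih₁ ih₂ => exact fun s => .andI (ih₁ s) (ih₂ s)
  | andE₁ _ ih => exact fun s => .andE₁ (ih s)
  | andE₂ _ ih => exact fun s => .andE₂ (ih s)
  | orI₁ _ ih => exact fun s => .orI₁ (ih s)
  | orI₂ _ ih => exact fun s => .orI₂ (ih s)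
  | orE _ _ _ ih₁ ih₂ ih₃ =>
    exact fun s => .orE (ih₁ s) (ih₂ (Set.insert_subset_insert s))
      (ih₃ (Set.insert_subset_insert s))
  | impI _ ih => exact fun s => .impI (ih (Set.insert_subset_insert s))
  | impE _ _ ih₁ ih₂ => exact fun s => .impE (ih₁ s) (ih₂ s)

theorem Derives.cut {n : ℕ} {Γ : Set (Formula n)} {φ ψ : Formula n}
    (h₁ : Derives Γ φ) (h₂ : Derives {φ} ψ) : Derives Γ ψ :=
  .impE (.impI (h₂.mono (by simp))) h₁

theorem Derives.hyp {n : ℕ} {φ : Formula n} : Derives {φ} φ := .ax rfl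

/-- Provable equivalence of formulae. -/
def formulaSetoid (n : ℕ) : Setoid (Formula n) where
  r φ ψ := Derives {φ} ψ ∧ Derives {ψ} φ
  iseqv :=
    { refl := fun _ => ⟨.hyp, .hyp⟩
      symm := fun h => ⟨h.2, h.1⟩
      trans := fun h k => ⟨h.1.cut k.1, k.2.cut h.2⟩ }

/-- The free Heyting algebra on `n` generators: formulae up to provable equivalence. -/
def FreeHA (n : ℕ) : Type := Quotient (formulaSetoid n)

namespace FreeHA

/-- The class of a formula. -/
def mk {n : ℕ} (φ : Formula n) : FreeHA n := Quotient.mk (formulaSetoid n) φ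

/-- The free generators `g_j`. -/
def gen {n : ℕ} (j : Fin n) : FreeHA n := mk (.var j)

theorem mk_surjective {n : ℕ} : Function.Surjective (mk (n := n)) := Quotient.mk_surjective

instance instPartialOrder (n : ℕ) : PartialOrder (FreeHA n) where
  le := Quotient.lift₂ (fun φ ψ => Derives {φ} ψ) (by
    intro a b c d h k
    exact propext ⟨fun e => (h.2.cut e).cut k.1, fun e => (h.1.cut e).cut k.2⟩)
  le_refl := by rintro ⟨φ⟩; exact Derives.hyp
  le_trans := by rintro ⟨φ⟩ ⟨ψ⟩ ⟨χ⟩ h k; exact Derives.cut h k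
  le_antisymm := by rintro ⟨φ⟩ ⟨ψ⟩ h k; exact Quotient.sound ⟨h, k⟩

theorem mk_le_mk {n : ℕ} {φ ψ : Formula n} : mk φ ≤ mk ψ ↔ Derives {φ} ψ := Iff.rfl

/-- The operations are induced by the connectives. -/
instance instHeytingAlgebra (n : ℕ) : HeytingAlgebra (FreeHA n) where
  __ := instPartialOrder n
  sup := Quotient.map₂ Formula.or (by
    intro a a' h b b' k
    exact ⟨.orE .hyp (.orI₁ (h.1.mono (by simp))) (.orI₂ (k.1.mono (by simp))),
      .orE .hyp (.orI₁ (h.2.mono (by simp))) (.orI₂ (k.2.mono (by simp)))⟩)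
  inf := Quotient.map₂ Formula.and (by
    intro a a' h b b' k
    exact ⟨.andI ((Derives.andE₁ .hyp).cut h.1) ((Derives.andE₂ .hyp).cut k.1),
      .andI ((Derives.andE₁ .hyp).cut h.2) ((Derives.andE₂ .hyp).cut k.2)⟩)
  himp := Quotient.map₂ Formula.imp (by
    intro a a' h b b' k
    exact ⟨.impI ((Derives.impE (.ax (by simp)) (h.2.mono (by simp))).cut k.1),
      .impI ((Derives.impE (.ax (by simp)) (h.1.mono (by simp))).cut k.2)⟩)
  compl := Quotient.map (fun φ => Formula.imp φ .bot) (by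
    intro a a' h
    exact ⟨.impI (Derives.impE (.ax (by simp)) (h.2.mono (by simp))),
      .impI (Derives.impE (.ax (by simp)) (h.1.mono (by simp)))⟩)
  top := mk (.imp .bot .bot)
  bot := mk .bot
  le_sup_left := by rintro ⟨φ⟩ ⟨ψ⟩; exact Derives.orI₁ .hyp
  le_sup_right := by rintro ⟨φ⟩ ⟨ψ⟩; exact Derives.orI₂ .hyp
  sup_le := by
    rintro ⟨φ⟩ ⟨ψ⟩ ⟨χ⟩ h k
    exact Derives.orE .hyp (Derives.mono h (by simp)) (Derives.mono k (by simp))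
  inf_le_left := by rintro ⟨φ⟩ ⟨ψ⟩; exact Derives.andE₁ .hyp
  inf_le_right := by rintro ⟨φ⟩ ⟨ψ⟩; exact Derives.andE₂ .hyp
  le_inf := by rintro ⟨φ⟩ ⟨ψ⟩ ⟨χ⟩ h k; exact Derives.andI h k
  le_top := by rintro ⟨φ⟩; exact Derives.impI (.ax (by simp))
  bot_le := by rintro ⟨φ⟩; exact Derives.botE .hyp
  le_himp_iff := by
    rintro ⟨φ⟩ ⟨ψ⟩ ⟨χ⟩
    refine ⟨fun h => ?_, fun h => ?_⟩
    · exact Derives.impE ((Derives.andE₁ .hyp).cut h) (.andE₂ .hyp)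
    · exact Derives.impI ((Derives.andI (.ax (by simp)) (.ax (by simp))).cut h)
  himp_bot := by rintro ⟨φ⟩; rfl

/-- Evaluation of a formula in a Heyting algebra. -/
def eval {n : ℕ} {A : Type*} [HeytingAlgebra A] (f : Fin n → A) : Formula n → A
  | .var j => f j
  | .bot => ⊥
  | .and φ ψ => eval f φ ⊓ eval f ψ
  | .or φ ψ => eval f φ ⊔ eval f ψ
  | .imp φ ψ => eval f φ ⇨ eval f ψ

theorem eval_sound {n : ℕ} {A : Type*} [HeytingAlgebra A] (f : Fin n → A)
    {Γ : Set (Formula n)} {φ : Formula n} (h : Derives Γ φ) :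
    ∀ a : A, (∀ γ ∈ Γ, a ≤ eval f γ) → a ≤ eval f φ := by
  induction h with
  | ax h => exact fun a s => s _ h
  | botE _ ih => exact fun a s => (ih a s).trans bot_le
  | andI _ _ ih₁ ih₂ => exact fun a s => le_inf (ih₁ a s) (ih₂ a s)
  | andE₁ _ ih => exact fun a s => (ih a s).trans inf_le_left
  | andE₂ _ ih => exact fun a s => (ih a s).trans inf_le_right
  | orI₁ _ ih => exact fun a s => (ih a s).trans le_sup_left
  | orI₂ _ ih => exact fun a s => (ih a s).trans le_sup_right
  | @orE Γ φ ψ χ _ _ _ ih₁ ih₂ ih₃ =>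
    intro a s
    have h := ih₁ a s
    have h₂ := ih₂ (a ⊓ eval f φ) (by
      rintro γ (rfl | hγ)
      exacts [inf_le_right, inf_le_left.trans (s _ hγ)])
    have h₃ := ih₃ (a ⊓ eval f ψ) (by
      rintro γ (rfl | hγ)
      exacts [inf_le_right, inf_le_left.trans (s _ hγ)])
    calc a = a ⊓ (eval f φ ⊔ eval f ψ) := (inf_eq_left.2 h).symm
      _ = (a ⊓ eval f φ) ⊔ (a ⊓ eval f ψ) := inf_sup_left _ _ _
      _ ≤ _ := sup_le h₂ h₃
  | @impI Γ φ ψ _ ih =>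
    intro a s
    refine le_himp_iff.2 (ih _ ?_)
    rintro γ (rfl | hγ)
    exacts [inf_le_right, inf_le_left.trans (s _ hγ)]
  | impE _ _ ih₁ ih₂ =>
    exact fun a s => (le_inf (ih₁ a s) (ih₂ a s)).trans himp_inf_le

/-- `FreeHA n` is freely generated by `gen`. -/
theorem existsUnique_hom {n : ℕ} {A : Type*} [HeytingAlgebra A] (f : Fin n → A) :
    ∃! h : HeytingHom (FreeHA n) A, ∀ j, h (gen j) = f j := by
  have le : ∀ {φ ψ : Formula n}, Derives {φ} ψ → eval f φ ≤ eval f ψ := fun h =>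
    eval_sound f h _ (by rintro γ rfl; exact le_rfl)
  let F : FreeHA n → A := Quotient.lift (eval f) fun _ _ h => le_antisymm (le h.1) (le h.2)
  refine ⟨⟨⟨⟨F, ?_⟩, ?_⟩, ?_, ?_⟩, fun j => rfl, fun h hh => ?_⟩
  · rintro ⟨φ⟩ ⟨ψ⟩; rfl
  · rintro ⟨φ⟩ ⟨ψ⟩; rfl
  · rfl
  · rintro ⟨φ⟩ ⟨ψ⟩; rfl
  · apply DFunLike.ext
    rintro ⟨φ⟩
    change h (mk φ) = eval f φ
    induction φ with
    | var j => exact hh j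
    | bot => exact map_bot h
    | and φ ψ h₁ h₂ => exact (map_inf h (mk φ) (mk ψ)).trans (by rw [h₁, h₂]; rfl)
    | or φ ψ h₁ h₂ => exact (map_sup h (mk φ) (mk ψ)).trans (by rw [h₁, h₂]; rfl)
    | imp φ ψ h₁ h₂ => exact (map_himp h (mk φ) (mk ψ)).trans (by rw [h₁, h₂]; rfl)

end FreeHA

/-! ### Kripke models -/

/-- A Kripke model on the poset `W`; truth is inherited downwards. A valuation is the set of
variables that it makes true. -/
structure KripkeModel (n : ℕ) (W : Type*) [PartialOrder W] where
  val : W → Finset (Fin n)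
  val_anti : ∀ {v w : W}, v ≤ w → val w ⊆ val v

namespace KripkeModel

/-- `M.Forces w φ` means `w ⊨ φ`. -/
def Forces {n : ℕ} {W : Type*} [PartialOrder W] (M : KripkeModel n W) : W → Formula n → Prop
  | w, .var j => j ∈ M.val w
  | _, .bot => False
  | w, .and φ ψ => M.Forces w φ ∧ M.Forces w ψ
  | w, .or φ ψ => M.Forces w φ ∨ M.Forces w ψ
  | w, .imp φ ψ => ∀ v, v ≤ w → M.Forces v φ → M.Forces v ψ

theorem Forces.anti {n : ℕ} {W : Type*} [PartialOrder W] {M : KripkeModel n W}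
    {φ : Formula n} : ∀ {v w : W}, v ≤ w → M.Forces w φ → M.Forces v φ := by
  induction φ with
  | var j => exact fun h k => M.val_anti h k
  | bot => exact fun _ k => k
  | and φ ψ h₁ h₂ => exact fun h k => ⟨h₁ h k.1, h₂ h k.2⟩
  | or φ ψ h₁ h₂ => exact fun h k => k.imp (h₁ h) (h₂ h)
  | imp φ ψ _ _ => exact fun h k u h' => k u (le_trans h' h)

/-- The set `⟦φ⟧` of points at which `φ` is valid, an element of the Heyting algebra of
decreasing sets. -/
def truthSet {n : ℕ} {W : Type*} [PartialOrder W] (M : KripkeModel n W) (φ : Formula n) :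
    LowerSet W where
  carrier := {w | M.Forces w φ}
  lower' := fun _ _ h k => Forces.anti h k

end KripkeModel

/-! ### The generic Kripke model

The formal points `w_{β,Y}`, with `β` a valuation and `Y` a finite set of previously constructed
points, are coded by natural numbers through a fixed injection `(β, Y) ↦ node β Y`. -/

/-- The formal point `w_{β,Y}`. -/
def node {n : ℕ} (β : Finset (Fin n)) (Y : Finset ℕ) : ℕ := Encodable.encode (β, Y)

/-- The pair `(β, Y)` coded by a formal point (with a default value on numbers that are
no codes). -/
def unnode (n : ℕ) (w : ℕ) : Finset (Fin n) × Finset ℕ :=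
  (Encodable.decode (α := Finset (Fin n) × Finset ℕ) w).getD (∅, ∅)

@[simp] theorem unnode_node {n : ℕ} (β : Finset (Fin n)) (Y : Finset ℕ) :
    unnode n (node β Y) = (β, Y) := by
  simp [unnode, node]

/-- The valuation of `w_{β,Y}` is `β`. -/
def nodeVal (n : ℕ) (w : ℕ) : Finset (Fin n) := (unnode n w).1

/-- `v ≤ w_{β,Y}` iff `v ∈ Y` or `v = w_{β,Y}`. -/
def NodeLE (n : ℕ) (v w : ℕ) : Prop := v ∈ (unnode n w).2 ∨ v = w

/-- `w_{β,Y}` may be added above the set of points `S`: `Y` is a decreasing subset of `S`,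
`β` is contained in all valuations of points of `Y`, and if `Y` is the decreasing set generated
by a point, then `β` differs from the valuation of that point. -/
structure Admissible {n : ℕ} (S : Set ℕ) (β : Finset (Fin n)) (Y : Finset ℕ) : Prop where
  subset : ∀ w ∈ Y, w ∈ S
  lower : ∀ w ∈ Y, ∀ v ∈ S, NodeLE n v w → v ∈ Y
  val_le : ∀ w ∈ Y, β ⊆ nodeVal n w
  val_ne : ∀ w ∈ S, (∀ v, v ∈ Y ↔ v ∈ S ∧ NodeLE n v w) → β ≠ nodeVal n w

/-- `level n d` is the set `K_n^{d-1}`, so that `level n 0 = K_n^{-1} = ∅`. -/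
def level (n : ℕ) : ℕ → Set ℕ
  | 0 => ∅
  | 1 => {w | ∃ (β : Finset (Fin n)) (Y : Finset ℕ), Admissible ∅ β Y ∧ w = node β Y}
  | d + 2 => level n (d + 1) ∪
      {w | ∃ (β : Finset (Fin n)) (Y : Finset ℕ), Admissible (level n (d + 1)) β Y ∧
        ¬ (↑Y ⊆ level n d) ∧ w = node β Y}

theorem level_mono_succ (n d : ℕ) : level n d ⊆ level n (d + 1) := by
  cases d with
  | zero => exact Set.empty_subset _
  | succ d => exact Set.subset_union_left

theorem level_mono (n : ℕ) : Monotone (level n) := monotone_nat_of_le_succ (level_mono_succ n)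

/-- A point that is new on a level is of the form `w_{β,Y}` with `Y` taken from the level
before. -/
theorem exists_admissible {n d w : ℕ} (h : w ∈ level n (d + 1)) (h' : w ∉ level n d) :
    ∃ (β : Finset (Fin n)) (Y : Finset ℕ), Admissible (level n d) β Y ∧ w = node β Y := by
  cases d with
  | zero => exact h
  | succ d =>
    rcases h with h | ⟨β, Y, h₁, _, h₂⟩
    · exact absurd h h'
    · exact ⟨β, Y, h₁, h₂⟩

/-- The underlying set `K_n`, the union of all the `K_n^d`. -/
def K (n : ℕ) : Type := {w : ℕ // ∃ d, w ∈ level n d}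

namespace K

/-- A point of `K_n` lies in some first level, and the set `Y` of the points strictly below it
is admissible over the level before. -/
theorem exists_first {n w : ℕ} (hw : ∃ d, w ∈ level n d) :
    ∃ d, w ∈ level n (d + 1) ∧ w ∉ level n d ∧
      Admissible (level n d) (nodeVal n w) (unnode n w).2 := by
  classical
  obtain ⟨d, hd⟩ : ∃ d, Nat.find hw = d + 1 := by
    refine Nat.exists_eq_succ_of_ne_zero fun h => ?_
    have := Nat.find_spec hw
    rw [h] at this
    exact this
  have h₁ : w ∈ level n (d + 1) := hd ▸ Nat.find_spec hw
  have h₂ : w ∉ level n d := Nat.find_min hw (by omega)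
  obtain ⟨β, Y, h, rfl⟩ := exists_admissible h₁ h₂
  exact ⟨d, h₁, h₂, by simpa [nodeVal] using h⟩

theorem nodeLE_trans {n u v w : ℕ} (hv : ∃ d, v ∈ level n d)
    (hw : ∃ d, w ∈ level n d) (h₁ : NodeLE n u v) (h₂ : NodeLE n v w) : NodeLE n u w := by
  rcases h₂ with h₂ | rfl
  · rcases h₁ with h | rfl
    · obtain ⟨d, _, _, hd⟩ := exists_first hw
      have hvd := hd.subset v h₂
      obtain ⟨e, _, he, hE⟩ := exists_first hv
      have hle : e ≤ d := by
        by_contra hlt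
        exact he (level_mono n (by omega) hvd)
      exact Or.inl (hd.lower v h₂ u (level_mono n hle (hE.subset u h)) (Or.inl h))
    · exact Or.inl h₂
  · exact h₁

theorem nodeLE_antisymm {n v w : ℕ} (hv : ∃ d, v ∈ level n d) (hw : ∃ d, w ∈ level n d)
    (h₁ : NodeLE n v w) (h₂ : NodeLE n w v) : v = w := by
  rcases h₁ with h₁ | h₁
  · rcases h₂ with h₂ | h₂
    · exfalso
      obtain ⟨d, _, hwd, hd⟩ := exists_first hw
      obtain ⟨e, _, hve, he⟩ := exists_first hv
      have a := hd.subset v h₁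
      have b := he.subset w h₂
      rcases le_total d e with h | h
      · exact hve (level_mono n h a)
      · exact hwd (level_mono n h b)
    · exact h₂.symm
  · exact h₁

instance instPartialOrder (n : ℕ) : PartialOrder (K n) where
  le v w := NodeLE n v.1 w.1
  le_refl _ := Or.inr rfl
  le_trans u v w := nodeLE_trans v.2 w.2
  le_antisymm v w h k := Subtype.ext (nodeLE_antisymm v.2 w.2 h k)

/-- The set `K_n^d`, as a set of points of `K_n`. -/
def upTo (n d : ℕ) : Set (K n) := {w | w.1 ∈ level n (d + 1)}

end K

/-- The generic Kripke model. -/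
def generic (n : ℕ) : KripkeModel n (K n) where
  val w := nodeVal n w.1
  val_anti := by
    intro v w h
    rcases h with h | h
    · obtain ⟨d, _, _, hd⟩ := K.exists_first w.2
      exact hd.val_le _ h
    · rw [h]

/-! ### The algebra of decreasing sets of the generic model, with its metric -/

/-- The Heyting algebra of all decreasing subsets of `K_n`. -/
abbrev Completion (n : ℕ) : Type := LowerSet (K n)

namespace Completion

/-- The indices `d` with `a ∩ K_n^d ≠ b ∩ K_n^d`. -/
def diffLevels {n : ℕ} (a b : Completion n) : Set ℕ :=
  {d | (a : Set (K n)) ∩ K.upTo n d ≠ (b : Set (K n)) ∩ K.upTo n d}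

open Classical in
/-- `d(a,b) = 2 ^ (- min {d | a ∩ K_n^d ≠ b ∩ K_n^d})`, with value `0` if there is no
such `d`. -/
noncomputable def distance {n : ℕ} (a b : Completion n) : ℝ :=
  if (diffLevels a b).Nonempty then (1 / 2 : ℝ) ^ sInf (diffLevels a b) else 0

theorem diffLevels_comm {n : ℕ} (a b : Completion n) : diffLevels a b = diffLevels b a := by
  ext d; exact ne_comm

theorem diffLevels_subset {n : ℕ} (a b c : Completion n) :
    diffLevels a c ⊆ diffLevels a b ∪ diffLevels b c := by
  intro d hd
  by_contra h
  simp only [Set.mem_union, not_or, diffLevels, Set.mem_ofPred_eq, not_not] at h hd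
  exact hd (h.1.trans h.2)

theorem distance_nonneg {n : ℕ} (a b : Completion n) : 0 ≤ distance a b := by
  unfold distance; split_ifs <;> positivity

theorem le_distance {n d : ℕ} {a b : Completion n} (h : d ∈ diffLevels a b) :
    (1 / 2 : ℝ) ^ d ≤ distance a b := by
  rw [distance, if_pos ⟨d, h⟩]
  exact pow_le_pow_of_le_one (by norm_num) (by norm_num) (Nat.sInf_le h)

theorem eq_of_distance_eq_zero {n : ℕ} {a b : Completion n} (h : distance a b = 0) : a = b := by
  have key : ∀ d, (a : Set (K n)) ∩ K.upTo n d = (b : Set (K n)) ∩ K.upTo n d := by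
    intro d
    by_contra hd
    have := le_distance (a := a) (b := b) (d := d) hd
    rw [h] at this
    exact absurd this (not_le.2 (by positivity))
  have mem : ∀ w : K n, ∃ d, w ∈ K.upTo n d := fun w =>
    let ⟨d, hd⟩ := w.2
    ⟨d, level_mono_succ n d hd⟩
  apply SetLike.ext
  intro w
  obtain ⟨d, hd⟩ := mem w
  have := Set.ext_iff.1 (key d) w
  simpa [hd] using this

noncomputable instance instMetricSpace (n : ℕ) : MetricSpace (Completion n) where
  dist := distance
  dist_self a := by simp [distance, diffLevels]
  dist_comm a b := by unfold distance; rw [diffLevels_comm]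
  dist_triangle a b c := by
    by_cases h : (diffLevels a c).Nonempty
    · have hc : distance a c = (1 / 2 : ℝ) ^ sInf (diffLevels a c) := if_pos h
      rw [hc]
      rcases diffLevels_subset a b c (Nat.sInf_mem h) with h' | h'
      · linarith [le_distance h', distance_nonneg b c]
      · linarith [le_distance h', distance_nonneg a b]
    · have hc : distance a c = 0 := if_neg h
      rw [hc]
      linarith [distance_nonneg a b, distance_nonneg b c]
  eq_of_dist_eq_zero := eq_of_distance_eq_zero

end Completion

/-! ### Heyting sub-algebras -/

/-- A Heyting sub-algebra: a subset containing `0` and `1` and closed under the operations. -/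
structure HeytingSubalgebra (A : Type*) [HeytingAlgebra A] extends Sublattice A where
  bot_mem' : ⊥ ∈ carrier
  top_mem' : ⊤ ∈ carrier
  himp_mem' : ∀ {a b}, a ∈ carrier → b ∈ carrier → a ⇨ b ∈ carrier

namespace HeytingSubalgebra

instance instSetLike (A : Type*) [HeytingAlgebra A] : SetLike (HeytingSubalgebra A) A where
  coe H := H.carrier
  coe_injective := by
    rintro ⟨⟨s, _, _⟩, _, _, _⟩ ⟨⟨t, _, _⟩, _, _, _⟩ h
    cases h; rfl

/-- The operations and the order are those of the ambient algebra. -/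
instance instHeytingAlgebra {A : Type*} [HeytingAlgebra A] (H : HeytingSubalgebra A) :
    HeytingAlgebra H where
  __ := (inferInstance : PartialOrder H)
  sup a b := ⟨a.1 ⊔ b.1, H.supClosed' a.2 b.2⟩
  inf a b := ⟨a.1 ⊓ b.1, H.infClosed' a.2 b.2⟩
  himp a b := ⟨a.1 ⇨ b.1, H.himp_mem' a.2 b.2⟩
  compl a := ⟨a.1 ⇨ ⊥, H.himp_mem' a.2 H.bot_mem'⟩
  top := ⟨⊤, H.top_mem'⟩
  bot := ⟨⊥, H.bot_mem'⟩
  le_sup_left a b := le_sup_left (a := a.1) (b := b.1)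
  le_sup_right a b := le_sup_right (a := a.1) (b := b.1)
  sup_le a b c := sup_le (a := a.1) (b := b.1) (c := c.1)
  inf_le_left a b := inf_le_left (a := a.1) (b := b.1)
  inf_le_right a b := inf_le_right (a := a.1) (b := b.1)
  le_inf a b c := le_inf (a := b.1) (b := c.1) (c := a.1)
  le_top a := le_top (a := a.1)
  bot_le a := bot_le (a := a.1)
  le_himp_iff a b c := le_himp_iff (a := a.1) (b := b.1) (c := c.1)
  himp_bot _ := rfl

end HeytingSubalgebra

/-! ### The ideal spectrum -/

/-- The set of prime ideals of `H`, ordered by inclusion. -/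
abbrev IdealSpec (H : Type*) [HeytingAlgebra H] : Type _ := {I : Order.Ideal H // I.IsPrime}

namespace IdealSpec

/-- The basic open set of the prime ideals that do not contain `a`. -/
def basicOpen {H : Type*} [HeytingAlgebra H] (a : H) : Set (IdealSpec H) := {I | a ∉ I.1}

/-- The Zariski topology. -/
instance zariski (H : Type*) [HeytingAlgebra H] : TopologicalSpace (IdealSpec H) :=
  TopologicalSpace.generateFrom (Set.range basicOpen)

theorem isTopologicalBasis_basicOpen (H : Type*) [HeytingAlgebra H] :
    TopologicalSpace.IsTopologicalBasis (Set.range (basicOpen (H := H))) where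
  exists_subset_inter := by
    rintro _ ⟨a, rfl⟩ _ ⟨b, rfl⟩ I ⟨ha, hb⟩
    refine ⟨_, ⟨a ⊓ b, rfl⟩, fun h => (I.2.mem_or_mem h).elim ha hb, fun J hJ => ⟨?_, ?_⟩⟩
    · exact fun h => hJ (J.1.lower inf_le_left h)
    · exact fun h => hJ (J.1.lower inf_le_right h)
  sUnion_eq := by
    refine Set.eq_univ_of_forall fun I => ⟨_, ⟨⊤, rfl⟩, ?_⟩
    have := I.2.toIsProper
    exact Order.Ideal.IsProper.top_notMem this
  eq_generateFrom := rfl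

end IdealSpec

/-- The principal ideal spectrum: the prime ideals generated by one element different from `1`,
with the order by inclusion and the trace of the Zariski topology. -/
abbrev PrincipalSpec (H : Type*) [HeytingAlgebra H] : Type _ :=
  {I : IdealSpec H // ∃ x : H, x ≠ ⊤ ∧ I.1 = Order.Ideal.principal x}

namespace PrincipalSpec

/-- The ideal underlying a point of the principal ideal spectrum. -/
def ideal {H : Type*} [HeytingAlgebra H] (I : PrincipalSpec H) : Order.Ideal H := I.1.1

/-- The trace of the basic open set given by `a`. -/
def basicOpen {H : Type*} [HeytingAlgebra H] (a : H) : Set (PrincipalSpec H) :=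
  {I | I.1 ∈ IdealSpec.basicOpen a}

end PrincipalSpec

end Bellissima

open Bellissima

/-!
Let `H` be an algebra of decreasing subsets of `K_n` that contains the sets `Iic w` and the
largest decreasing sets `notAbove w = {v | ¬ w ≤ v}` avoiding a given point. The elements of `H`
that avoid `w` form the ideal generated by `notAbove w`, which is prime. Conversely, the complement
of a prime element of `H` is directed downwards, as one sees by testing primality on the sets
`Iic u`; since `K_n` is well-founded, it has a least element `w`, and the ideal is the one of `w`
(`exists_mem_ideal_iff`). This gives the isomorphism (`exists_orderIso`), and as the basic open
set of `Iic w` consists of the points below `w`, all decreasing subsets of the spectrum are open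
(`isOpen_iff_isLowerSet`). It remains to place the three kinds of algebras under this criterion.

For the algebra of all decreasing sets there is nothing to prove. For a dense subalgebra, every
point outside `K_n^k` lies above a point that is new on level `k`
(`K.exists_le_of_notMem_level`); so a decreasing set contained in a level is an isolated
point of the metric space, and belongs to every dense subset (`Completion.mem_of_dense`).

For the free algebra there are two things to show. First, formulae separate its elements on `K_n`
(`le_of_truthHom_le`): a non-derivable sequent fails in a finite model, whose points are the prime
theories within a finite set of formulae closed under subformulae (`forces_canonicalModel`), and
each point of a finite model has the theory of some point of `K_n`
(`KripkeModel.exists_generic_forces_iff`). Second, the sets `Iic w` and `notAbove w` are defined by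
formulae, by recursion on `w` (`exists_truthHom_eq_Iic`). The recursion rests on the two
properties of formal points: `w_{β,Y}` is determined by `β` and `Y`, and no point has a unique
lower cover with the same valuation.
-/

namespace Bellissima

/-! ### The order of the generic model -/

namespace K

variable {n : ℕ}

theorem lt_iff {v w : K n} : v < w ↔ v.1 ∈ (unnode n w.1).2 := by
  refine ⟨fun h => h.le.resolve_right fun e => h.ne (Subtype.ext e), fun h => ?_⟩
  refine lt_of_le_of_ne (Or.inl h) ?_
  rintro rfl
  obtain ⟨d, _, h₂, h₃⟩ := exists_first v.2
  exact h₂ (h₃.subset _ h)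

theorem finite_Iio (w : K n) : (Set.Iio w).Finite := by
  refine Set.Finite.of_finite_image (f := Subtype.val)
    ((unnode n w.1).2.finite_toSet.subset ?_) Subtype.val_injective.injOn
  rintro _ ⟨v, hv, rfl⟩
  exact lt_iff.1 hv

theorem finite_Iic (w : K n) : (Set.Iic w).Finite := by
  rw [← Set.Iio_insert]
  exact (finite_Iio w).insert w

instance instWellFoundedLT : WellFoundedLT (K n) where
  wf := Subrelation.wf (r := InvImage (· < ·) fun w : K n => (Set.Iio w).ncard)
    (fun {_ w} h => Set.ncard_lt_ncard
      ⟨fun _ hu => lt_trans hu h, fun hs => lt_irrefl _ (Set.mem_Iio.1 (hs h))⟩ (finite_Iio w))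
    (InvImage.wf _ Nat.lt_wfRel.wf)

/-- The levels are decreasing sets: everything below a point of `K_n^{d-1}` lies in it. -/
theorem mem_level_of_le {v w : K n} {d : ℕ} (h : v ≤ w) (hw : w.1 ∈ level n d) :
    v.1 ∈ level n d := by
  rcases h.eq_or_lt with rfl | h
  · exact hw
  · obtain ⟨e, _, h₂, h₃⟩ := exists_first w.2
    have hed : e ≤ d := by
      by_contra hlt
      exact h₂ (level_mono n (by omega) hw)
    exact level_mono n hed (h₃.subset _ (lt_iff.1 h))

/-- A point `w_{β,Y}` is determined by its valuation and by the points strictly below it. -/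
theorem eq_of_val_eq {v w : K n} (hval : (generic n).val v = (generic n).val w)
    (hlt : ∀ u, u < v ↔ u < w) : v = w := by
  have code : ∀ u : K n, u.1 = node (nodeVal n u.1) (unnode n u.1).2 := by
    intro u
    obtain ⟨d, h₁, h₂, _⟩ := exists_first u.2
    obtain ⟨β, Y, _, h⟩ := exists_admissible h₁ h₂
    rw [h]
    simp [nodeVal]
  have mem : ∀ (u : K n) (x : ℕ), x ∈ (unnode n u.1).2 → ∃ d, x ∈ level n d := by
    intro u x hx
    obtain ⟨d, _, _, h⟩ := exists_first u.2
    exact ⟨d, h.subset x hx⟩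
  have hY : (unnode n v.1).2 = (unnode n w.1).2 := by
    ext x
    exact ⟨fun hx => lt_iff.1 ((hlt ⟨x, mem v x hx⟩).1 (lt_iff.2 hx)),
      fun hx => lt_iff.1 ((hlt ⟨x, mem w x hx⟩).2 (lt_iff.2 hx))⟩
  apply Subtype.ext
  rw [code v, code w, hY, show nodeVal n v.1 = nodeVal n w.1 from hval]

/-- The side condition on formal points: a point with a single lower cover has a valuation
different from that of the cover. -/
theorem val_ne_of_lt_iff_le {t w : K n} (h : ∀ v, v < t ↔ v ≤ w) :
    (generic n).val t ≠ (generic n).val w := by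
  obtain ⟨d, _, _, ht⟩ := exists_first t.2
  have hw : w < t := (h w).2 le_rfl
  refine ht.val_ne w.1 (ht.subset _ (lt_iff.1 hw)) fun v => ⟨fun hv => ?_, fun hv => ?_⟩
  · have hvd := ht.subset v hv
    exact ⟨hvd, (h ⟨v, d, hvd⟩).1 (lt_iff.2 hv)⟩
  · exact lt_iff.1 ((h ⟨v, d, hv.1⟩).2 hv.2)

/-- The generic model contains all the formal points `w_{β,Y}`: the restrictions on the levels
only serve to introduce each of them once. -/
theorem exists_of_lowerSet (β : Finset (Fin n)) {Y : Set (K n)} (hfin : Y.Finite)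
    (hlow : IsLowerSet Y) (hβ : ∀ w ∈ Y, β ⊆ (generic n).val w)
    (hne : ∀ w, (∀ v, v ∈ Y ↔ v ≤ w) → β ≠ (generic n).val w) :
    ∃ t : K n, (generic n).val t = β ∧ ∀ v, v < t ↔ v ∈ Y := by
  classical
  let Z : Finset ℕ := hfin.toFinset.image fun v : K n => v.1
  have hZ : ∀ v : K n, v.1 ∈ Z ↔ v ∈ Y := by
    intro v
    simp only [Z, Finset.mem_image, Set.Finite.mem_toFinset]
    exact ⟨fun ⟨u, hu, h⟩ => Subtype.ext h ▸ hu, fun h => ⟨v, h, rfl⟩⟩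
  have hZK : ∀ x ∈ Z, ∃ u : K n, u.1 = x := by
    intro x hx
    obtain ⟨u, _, rfl⟩ := Finset.mem_image.1 hx
    exact ⟨u, rfl⟩
  have hex : ∃ d, ∀ x ∈ Z, x ∈ level n d := by
    have : ∀ x : ℕ, ∃ d, x ∈ Z → x ∈ level n d := by
      intro x
      by_cases hx : x ∈ Z
      · obtain ⟨u, rfl⟩ := hZK x hx
        obtain ⟨d, hd⟩ := u.2
        exact ⟨d, fun _ => hd⟩
      · exact ⟨0, fun h => absurd h hx⟩
    choose d hd using this
    exact ⟨Z.sup d, fun x hx => level_mono n (Finset.le_sup hx) (hd x hx)⟩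
  -- `d` is the first level that contains `Y`, so that `w_{β,Y}` is added on the next one.
  obtain ⟨d, hd, hmin⟩ : ∃ d, (∀ x ∈ Z, x ∈ level n d) ∧
      ∀ e < d, ¬ ∀ x ∈ Z, x ∈ level n e :=
    ⟨Nat.find hex, Nat.find_spec hex, fun _ he => Nat.find_min hex he⟩
  have hadm : Admissible (level n d) β Z := by
    refine ⟨hd, fun w hw v hv hvw => ?_, fun w hw => ?_, fun w hw h => ?_⟩
    · obtain ⟨w, rfl⟩ := hZK w hw
      exact (hZ ⟨v, d, hv⟩).2 (hlow (a := w) (b := ⟨v, d, hv⟩) hvw ((hZ w).1 hw))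
    · obtain ⟨w, rfl⟩ := hZK w hw
      exact hβ w ((hZ w).1 hw)
    · refine hne ⟨w, d, hw⟩ fun v => ?_
      rw [← hZ, h]
      exact ⟨fun h => h.2, fun h' => ⟨mem_level_of_le h' hw, h'⟩⟩
  have hmem : node β Z ∈ level n (d + 1) := by
    cases d with
    | zero => exact ⟨β, Z, hadm, rfl⟩
    | succ d => exact Or.inr ⟨β, Z, hadm, hmin d (Nat.lt_succ_self d), rfl⟩
  let t : K n := ⟨node β Z, d + 1, hmem⟩
  have ht : unnode n t.1 = (β, Z) := unnode_node β Z
  refine ⟨t, congrArg Prod.fst ht, fun v => ?_⟩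
  rw [lt_iff, ← hZ, ht]

instance instNonempty : Nonempty (K n) :=
  let ⟨t, _⟩ := exists_of_lowerSet ∅ (Y := (∅ : Set (K n))) Set.finite_empty isLowerSet_empty
    (fun _ h => h.elim) fun w h => ((h w).2 le_rfl).elim
  ⟨t⟩

/-- A point outside `K_n^k` lies above a point that is new on level `k`, because every new
point of `K_n^d` has a new point of `K_n^{d-1}` below it. -/
theorem exists_le_of_notMem_level {k : ℕ} (u : K n) (hu : u.1 ∉ level n (k + 1)) :
    ∃ v ≤ u, v.1 ∈ level n (k + 1) ∧ v.1 ∉ level n k := by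
  induction u using WellFoundedLT.induction with
  | ind u ih =>
    obtain ⟨d, h₁, h₂, h₃⟩ := exists_first u.2
    have hkd : k + 1 ≤ d := by
      by_contra hlt
      exact hu (level_mono n (by omega) h₁)
    obtain ⟨e, rfl⟩ : ∃ e, d = e + 1 := ⟨d - 1, by omega⟩
    rcases h₁ with h₁ | ⟨β, Y, _, hY, hw⟩
    · exact absurd h₁ h₂
    · obtain ⟨x, hxY, hxe⟩ := Set.not_subset.1 hY
      have hx : x ∈ (unnode n u.1).2 := by rw [hw]; simpa using hxY
      let v : K n := ⟨x, e + 1, h₃.subset x hx⟩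
      have hvu : v < u := lt_iff.2 hx
      by_cases hv : x ∈ level n (k + 1)
      · exact ⟨v, hvu.le, hv, fun h => hxe (level_mono n (by omega) h)⟩
      · obtain ⟨t, ht, h⟩ := ih v hvu hv
        exact ⟨t, ht.trans hvu.le, h⟩

end K

/-! ### The algebra of decreasing sets -/

namespace Completion

variable {n : ℕ}

theorem mem_himp {A B : Completion n} {w : K n} :
    w ∈ A ⇨ B ↔ ∀ v ≤ w, v ∈ A → v ∈ B := by
  rw [← LowerSet.Iic_le, le_himp_iff]
  exact ⟨fun h v hv hA => h ⟨hv, hA⟩, fun h v hv => h v hv.1 hv.2⟩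

/-- The largest decreasing set that does not contain `w`. -/
def notAbove (w : K n) : Completion n where
  carrier := {v | ¬ w ≤ v}
  lower' := fun _ _ h k k' => k (k'.trans h)

theorem mem_notAbove {v w : K n} : v ∈ notAbove w ↔ ¬ w ≤ v := Iff.rfl

theorem le_notAbove {w : K n} {A : Completion n} : A ≤ notAbove w ↔ w ∉ A :=
  ⟨fun h hw => h hw le_rfl, fun hw _ hv hwv => hw (A.lower hwv hv)⟩

theorem Iic_himp_Iio (w : K n) : LowerSet.Iic w ⇨ LowerSet.Iio w = notAbove w := by
  ext v
  rw [SetLike.mem_coe, SetLike.mem_coe, mem_himp, mem_notAbove]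
  exact ⟨fun h hwv => lt_irrefl w (h w hwv (LowerSet.mem_Iic_iff.2 le_rfl)),
    fun h u hu huw => lt_of_le_of_ne huw fun e => h (e.symm.le.trans hu)⟩

theorem mem_finset_sup {ι : Type*} {s : Finset ι} {A : ι → Completion n} {w : K n} :
    w ∈ s.sup A ↔ ∃ i ∈ s, w ∈ A i := by
  simp [Finset.sup_eq_iSup]

theorem mem_finset_inf {ι : Type*} {s : Finset ι} {A : ι → Completion n} {w : K n} :
    w ∈ s.inf A ↔ ∀ i ∈ s, w ∈ A i := by
  simp [Finset.inf_eq_iInf]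

end Completion

/-! ### The spectrum of an algebra of decreasing sets -/

section Spectrum

variable {n : ℕ} {H : Type*} [HeytingAlgebra H]

/-- The points of the generic model as principal primes of an algebra `H` of decreasing sets,
where `x w` is the largest element of `H` that does not contain `w`. -/
def spectrumPoint (f : HeytingHom H (Completion n)) (x : K n → H)
    (hx : ∀ w a, a ≤ x w ↔ w ∉ f a) (w : K n) : PrincipalSpec H :=
  ⟨⟨Order.Ideal.principal (x w), by
      have : (Order.Ideal.principal (x w)).IsProper := by
        refine Order.Ideal.isProper_of_notMem (p := ⊤) ?_
        rw [Order.Ideal.mem_principal, hx, map_top]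
        simp
      refine Order.Ideal.IsPrime.of_mem_or_mem fun {a b} h => ?_
      rw [Order.Ideal.mem_principal, hx] at h ⊢
      rw [Order.Ideal.mem_principal, hx]
      rw [map_inf, LowerSet.mem_inf_iff] at h
      tauto⟩,
    x w, by
      intro h
      have := (hx w ⊤).1 (h ▸ le_rfl)
      rw [map_top] at this
      simp at this, rfl⟩

variable {f : HeytingHom H (Completion n)}

/-- The complement of a prime proper decreasing set is directed downwards; as the generic model
is well-founded, it has a least element, and the principal prime is given by that point. -/
theorem exists_mem_ideal_iff (hf : ∀ a b, f a ≤ f b → a ≤ b)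
    (hIic : ∀ w, ∃ a, f a = LowerSet.Iic w) (I : PrincipalSpec H) :
    ∃ w, ∀ a, a ∈ I.ideal ↔ w ∉ f a := by
  obtain ⟨⟨I, hI⟩, y, hy, h⟩ := I
  obtain rfl : I = Order.Ideal.principal y := h
  have hne : {v | v ∉ f y}.Nonempty := by
    by_contra hcon
    rw [Set.not_nonempty_iff_eq_empty, Set.eq_empty_iff_forall_notMem] at hcon
    exact hy (top_le_iff.1 (hf _ _ fun v _ => not_not.1 (hcon v)))
  obtain ⟨w, hw, hmin⟩ := WellFounded.has_min (wellFounded_lt (α := K n)) _ hne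
  have hleast : ∀ v, v ∉ f y → w ≤ v := by
    intro v hv
    obtain ⟨a, ha⟩ := hIic w
    obtain ⟨b, hb⟩ := hIic v
    have hnot : ¬ f (a ⊓ b) ≤ f y := by
      intro hle
      rcases hI.mem_or_mem (x := a) (y := b) (hf _ _ hle) with h | h
      · exact hw (OrderHomClass.mono f h (ha ▸ LowerSet.mem_Iic_iff.2 le_rfl))
      · exact hv (OrderHomClass.mono f h (hb ▸ LowerSet.mem_Iic_iff.2 le_rfl))
    obtain ⟨u, hu, huy⟩ := Set.not_subset.1 hnot
    rw [map_inf, ha, hb] at hu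
    exact (eq_of_le_of_not_lt hu.1 (hmin u huy)).symm.trans_le hu.2
  refine ⟨w, fun a => ⟨fun ha h => hw (OrderHomClass.mono f ha h), fun ha => hf _ _ ?_⟩⟩
  intro v hv
  by_contra hvy
  exact ha ((f a).lower (hleast v hvy) hv)

/-- If an algebra of decreasing sets contains all sets `Iic w`, then its principal prime spectrum
is the generic model. -/
theorem exists_orderIso (hf : ∀ a b, f a ≤ f b → a ≤ b)
    (hIic : ∀ w, ∃ a, f a = LowerSet.Iic w) (hnot : ∀ w, ∃ a, f a = Completion.notAbove w) :
    ∃ e : K n ≃o PrincipalSpec H, ∀ w a, a ∈ (e w).ideal ↔ w ∉ f a := by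
  choose x hx using hnot
  have hle : ∀ w a, a ≤ x w ↔ w ∉ f a := by
    intro w a
    rw [← Completion.le_notAbove, ← hx]
    exact ⟨fun h => OrderHomClass.mono f h, hf _ _⟩
  have hmem : ∀ w a, a ∈ (spectrumPoint f x hle w).ideal ↔ w ∉ f a := hle
  have hord : ∀ v w, spectrumPoint f x hle v ≤ spectrumPoint f x hle w ↔ v ≤ w := by
    refine fun v w => ⟨fun h => ?_, fun h a ha => ?_⟩
    · obtain ⟨a, ha⟩ := hIic w
      by_contra hvw
      have hva : a ∈ (spectrumPoint f x hle v).ideal := by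
        rw [hmem, ha]
        exact hvw
      exact (hmem w a).1 (h hva) (ha ▸ LowerSet.mem_Iic_iff.2 le_rfl)
    · exact (hmem w a).2 fun hw => (hmem v a).1 ha ((f a).lower h hw)
  refine ⟨⟨Equiv.ofBijective _ ⟨fun v w h => ?_, fun I => ?_⟩, fun {v w} => hord v w⟩, hmem⟩
  · exact le_antisymm ((hord v w).1 h.le) ((hord w v).1 h.ge)
  · obtain ⟨w, hw⟩ := exists_mem_ideal_iff hf hIic I
    exact ⟨w, Subtype.ext (Subtype.ext (Order.Ideal.ext (Set.ext fun a =>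
      (hmem w a).trans (hw a).symm)))⟩

/-- Under the same hypothesis the Zariski topology is the topology of decreasing sets: the basic
open set given by `Iic w` consists of the points below `w`. -/
theorem isOpen_iff_isLowerSet (hf : ∀ a b, f a ≤ f b → a ≤ b)
    (hIic : ∀ w, ∃ a, f a = LowerSet.Iic w) (U : Set (PrincipalSpec H)) :
    IsOpen U ↔ IsLowerSet U := by
  refine ⟨fun h => ?_, fun h => ?_⟩
  · obtain ⟨V, hV, rfl⟩ := isOpen_induced_iff.1 h
    intro I J hJI hI
    obtain ⟨_, ⟨a, rfl⟩, ha, haV⟩ :=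
      (IdealSpec.isTopologicalBasis_basicOpen H).exists_subset_of_mem_open hI hV
    exact haV fun hJ => ha (hJI hJ)
  · refine isOpen_iff_mem_nhds.2 fun I hI => ?_
    obtain ⟨w, hw⟩ := exists_mem_ideal_iff hf hIic I
    obtain ⟨a, ha⟩ := hIic w
    have hopen : IsOpen (PrincipalSpec.basicOpen a) :=
      ((IdealSpec.isTopologicalBasis_basicOpen H).isOpen ⟨a, rfl⟩).preimage
        continuous_subtype_val
    refine Filter.mem_of_superset (hopen.mem_nhds (x := I) ?_) fun J hJ => h ?_ hI
    · change ¬ a ∈ I.ideal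
      rw [hw, ha, not_not]
      exact LowerSet.mem_Iic_iff.2 le_rfl
    · obtain ⟨v, hv⟩ := exists_mem_ideal_iff hf hIic J
      have hva : v ∈ f a := by
        by_contra hcon
        exact hJ ((hv a).2 hcon)
      rw [ha] at hva
      intro b hb
      exact (hw b).2 fun hwb => (hv b).1 hb ((f b).lower hva hwb)

end Spectrum

/-! ### Finite models in the generic model -/

/-- Every point of a finite model has the same theory as some point of the generic model. Points
with the theories of the points strictly below `m` being given, the decreasing set `Y` that they
generate has either a formal point `w_{β,Y}` above it, with `β` the valuation of `m`, or is
generated by one point with valuation `β`. -/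
theorem KripkeModel.exists_generic_forces_iff {n : ℕ} {W : Type*} [PartialOrder W] [Finite W]
    (M : KripkeModel n W) (m : W) :
    ∃ t : K n, ∀ φ, (generic n).Forces t φ ↔ M.Forces m φ := by
  induction m using WellFoundedLT.induction with
  | ind m ih =>
    choose! g hg using ih
    let Y : Set (K n) := {u | ∃ m' < m, u ≤ g m'}
    have hfin : Y.Finite := by
      refine (Set.Finite.biUnion (Set.toFinite (Set.Iio m))
        fun m' _ => K.finite_Iic (g m')).subset ?_
      rintro u ⟨m', hm', hu⟩
      exact Set.mem_biUnion hm' hu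
    have hlow : IsLowerSet Y := fun u v hvu ⟨m', hm', hu⟩ => ⟨m', hm', hvu.trans hu⟩
    have hβ : ∀ w ∈ Y, M.val m ⊆ (generic n).val w := by
      rintro w ⟨m', hm', hw⟩
      refine subset_trans (fun j hj => ?_) ((generic n).val_anti hw)
      exact (hg m' hm' (.var j)).2 (M.val_anti hm'.le hj)
    obtain ⟨t, hval, ht⟩ : ∃ t : K n, (generic n).val t = M.val m ∧
        ∀ v, v ≤ t ↔ v = t ∨ ∃ m' < m, v ≤ g m' := by
      by_cases h : ∃ w, (∀ v, v ∈ Y ↔ v ≤ w) ∧ M.val m = (generic n).val w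
      · obtain ⟨w, hw, hval⟩ := h
        exact ⟨w, hval.symm, fun v => ⟨fun hv => Or.inr ((hw v).2 hv),
          fun hv => hv.elim le_of_eq (hw v).1⟩⟩
      · obtain ⟨t, hval, ht⟩ := K.exists_of_lowerSet _ hfin hlow hβ
          fun w hw hval => h ⟨w, hw, hval⟩
        exact ⟨t, hval, fun v => by rw [le_iff_eq_or_lt, ht]; rfl⟩
    refine ⟨t, fun φ => ?_⟩
    induction φ with
    | var j => exact iff_of_eq (congrArg (j ∈ ·) hval)
    | bot => exact Iff.rfl
    | and φ ψ h₁ h₂ => exact and_congr h₁ h₂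
    | or φ ψ h₁ h₂ => exact or_congr h₁ h₂
    | imp φ ψ h₁ h₂ =>
      refine ⟨fun h m' hm' hφ => ?_, fun h v hv hφ => ?_⟩
      · rcases hm'.eq_or_lt with rfl | hlt
        · exact h₂.1 (h t le_rfl (h₁.2 hφ))
        · exact (hg m' hlt ψ).1 (h _ ((ht _).2 (Or.inr ⟨m', hlt, le_rfl⟩))
            ((hg m' hlt φ).2 hφ))
      · rcases (ht v).1 hv with rfl | ⟨m', hm', hv'⟩
        · exact h₂.2 (h m le_rfl (h₁.1 hφ))
        · exact (hg m' hm' (.imp φ ψ)).2 (fun u hu => h u (hu.trans hm'.le)) v hv' hφ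

/-! ### Completeness of intuitionistic logic for the generic model -/

/-- The immediate subformulae of a formula. -/
def Formula.children {n : ℕ} : Formula n → Set (Formula n)
  | .var _ => ∅
  | .bot => ∅
  | .and φ ψ => {φ, ψ}
  | .or φ ψ => {φ, ψ}
  | .imp φ ψ => {φ, ψ}

/-- A set of formulae is closed under passing to subformulae. -/
def SubformulaClosed {n : ℕ} (S : Set (Formula n)) : Prop :=
  ∀ χ ∈ S, χ.children ⊆ S

theorem SubformulaClosed.union {n : ℕ} {S T : Set (Formula n)} (hS : SubformulaClosed S)
    (hT : SubformulaClosed T) : SubformulaClosed (S ∪ T) := by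
  rintro χ (h | h)
  · exact (hS χ h).trans Set.subset_union_left
  · exact (hT χ h).trans Set.subset_union_right

theorem SubformulaClosed.insert {n : ℕ} {S : Set (Formula n)} (hS : SubformulaClosed S)
    {χ : Formula n} (hχ : χ.children ⊆ S) : SubformulaClosed (insert χ S) := by
  rintro ξ (rfl | h)
  · exact hχ.trans (Set.subset_insert _ _)
  · exact (hS ξ h).trans (Set.subset_insert _ _)

theorem exists_finite_subformulaClosed {n : ℕ} (φ : Formula n) :
    ∃ S : Set (Formula n), S.Finite ∧ SubformulaClosed S ∧ φ ∈ S := by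
  have hinsert : ∀ (S : Set (Formula n)) (χ : Formula n), S.Finite → SubformulaClosed S →
      χ.children ⊆ S → ∃ S : Set (Formula n), S.Finite ∧ SubformulaClosed S ∧ χ ∈ S :=
    fun S χ hS cS hχ => ⟨insert χ S, hS.insert χ, cS.insert hχ, Set.mem_insert χ S⟩
  have hempty : SubformulaClosed (∅ : Set (Formula n)) := fun _ h => h.elim
  induction φ with
  | var j => exact hinsert ∅ _ Set.finite_empty hempty le_rfl
  | bot => exact hinsert ∅ _ Set.finite_empty hempty le_rfl
  | and φ ψ h₁ h₂ | or φ ψ h₁ h₂ | imp φ ψ h₁ h₂ =>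
    obtain ⟨S, hS, cS, mS⟩ := h₁
    obtain ⟨T, hT, cT, mT⟩ := h₂
    exact hinsert (S ∪ T) _ (hS.union hT) (cS.union cT)
      (Set.pair_subset (.inl mS) (.inr mT))

/-- A prime ideal separates `b` from `a` if `a ≰ b`. -/
theorem exists_isPrime_of_not_le {A : Type*} [DistribLattice A] {a b : A} (h : ¬ a ≤ b) :
    ∃ I : Order.Ideal A, I.IsPrime ∧ b ∈ I ∧ a ∉ I := by
  obtain ⟨I, hI, hb, ha⟩ := DistribLattice.prime_ideal_of_disjoint_filter_ideal
    (F := Order.PFilter.principal a) (I := Order.Ideal.principal b) (by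
      refine Set.disjoint_left.2 fun x hx hx' => h ?_
      exact le_trans (Order.PFilter.mem_principal.1 hx) (Order.Ideal.mem_principal.1 hx'))
  exact ⟨I, hI, hb (Order.Ideal.mem_principal.2 le_rfl),
    Set.disjoint_left.1 ha (Order.PFilter.mem_principal.2 le_rfl)⟩

theorem finset_inf_notMem {A ι : Type*} [DistribLattice A] [OrderTop A] {I : Order.Ideal A}
    (hI : I.IsPrime) (s : Finset ι) (x : ι → A) (h : ∀ i ∈ s, x i ∉ I) : s.inf x ∉ I := by
  classical
  induction s using Finset.induction_on with
  | empty =>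
    have := hI.toIsProper
    rw [Finset.inf_empty]
    exact Order.Ideal.IsProper.top_notMem this
  | insert i s _ ih =>
    rw [Finset.inf_insert]
    intro hmem
    rcases hI.mem_or_mem hmem with h' | h'
    · exact h i (Finset.mem_insert_self i s) h'
    · exact ih (fun j hj => h j (Finset.mem_insert_of_mem hj)) h'

/-- The formulae of `S` whose class lies in the prime filter complementary to `I`. -/
def theoryOf {n : ℕ} (S : Set (Formula n)) (I : Order.Ideal (FreeHA n)) : Set (Formula n) :=
  {φ | φ ∈ S ∧ FreeHA.mk φ ∉ I}

/-- The points of the canonical model over `S`: the prime theories within `S`. The order is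
the reverse of inclusion, because truth is inherited downwards. -/
abbrev CanonicalPoint {n : ℕ} (S : Set (Formula n)) : Type :=
  {T : (Set (Formula n))ᵒᵈ //
    ∃ I : Order.Ideal (FreeHA n), I.IsPrime ∧ OrderDual.ofDual T = theoryOf S I}

/-- The canonical model over `S`: a variable is true at a theory that contains it. -/
noncomputable def canonicalModel {n : ℕ} (S : Set (Formula n)) :
    KripkeModel n (CanonicalPoint S) where
  val T := by
    classical
    exact Finset.univ.filter fun j => Formula.var j ∈ OrderDual.ofDual T.1
  val_anti := by
    intro T T' h j hj
    simp only [Finset.mem_filter, Finset.mem_univ, true_and] at hj ⊢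
    exact h hj

theorem finite_canonicalPoint {n : ℕ} {S : Set (Formula n)} (hS : S.Finite) :
    Finite (CanonicalPoint S) := by
  refine Set.Finite.to_subtype (Set.Finite.subset (Set.Finite.preimage
    OrderDual.ofDual.injective.injOn hS.finite_subsets) ?_)
  rintro T ⟨I, _, h⟩ φ hφ
  rw [h] at hφ
  exact hφ.1

/-- The truth lemma for the canonical model. -/
theorem forces_canonicalModel {n : ℕ} {S : Set (Formula n)} (hS : S.Finite)
    (hc : SubformulaClosed S) {φ : Formula n} (hφ : φ ∈ S) (T : CanonicalPoint S) :
    (canonicalModel S).Forces T φ ↔ φ ∈ OrderDual.ofDual T.1 := by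
  induction φ generalizing T with
  | var j => simp [KripkeModel.Forces, canonicalModel]
  | bot =>
    obtain ⟨T, I, hI, h⟩ := T
    refine iff_of_false id fun hT => ?_
    rw [h] at hT
    exact hT.2 I.bot_mem
  | and φ ψ h₁ h₂ =>
    have hs := Set.pair_subset_iff.1 (hc _ hφ)
    refine (and_congr (h₁ hs.1 T) (h₂ hs.2 T)).trans ?_
    obtain ⟨T, I, hI, h⟩ := T
    rw [h]
    have : FreeHA.mk (.and φ ψ) = FreeHA.mk φ ⊓ FreeHA.mk ψ := rfl
    simp only [theoryOf, Set.mem_ofPred_eq, hs.1, hs.2, hφ, true_and, this]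
    refine ⟨fun h h' => (hI.mem_or_mem h').elim h.1 h.2, fun h => ⟨fun h' => ?_, fun h' => ?_⟩⟩
    · exact h (I.lower inf_le_left h')
    · exact h (I.lower inf_le_right h')
  | or φ ψ h₁ h₂ =>
    have hs := Set.pair_subset_iff.1 (hc _ hφ)
    refine (or_congr (h₁ hs.1 T) (h₂ hs.2 T)).trans ?_
    obtain ⟨T, I, hI, h⟩ := T
    rw [h]
    have : FreeHA.mk (.or φ ψ) = FreeHA.mk φ ⊔ FreeHA.mk ψ := rfl
    simp only [theoryOf, Set.mem_ofPred_eq, hs.1, hs.2, hφ, true_and, this,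
      Order.Ideal.sup_mem_iff]
    tauto
  | imp φ ψ h₁ h₂ =>
    have hs := Set.pair_subset_iff.1 (hc _ hφ)
    have himp : FreeHA.mk (.imp φ ψ) = FreeHA.mk φ ⇨ FreeHA.mk ψ := rfl
    constructor
    · intro hforce
      obtain ⟨T, I, hI, h⟩ := T
      rw [h]
      refine ⟨hφ, fun hmem => ?_⟩
      -- If the implication fails, extend the theory by `φ` to a prime theory without `ψ`.
      have hfin : (theoryOf S I).Finite := hS.subset fun _ h => h.1
      have hnle : ¬ hfin.toFinset.inf FreeHA.mk ⊓ FreeHA.mk φ ≤ FreeHA.mk ψ := by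
        rw [← le_himp_iff, ← himp]
        intro hle
        refine finset_inf_notMem hI hfin.toFinset FreeHA.mk (fun χ hχ => ?_) (I.lower hle hmem)
        exact (hfin.mem_toFinset.1 hχ).2
      obtain ⟨J, hJ, hψ, hJnot⟩ := exists_isPrime_of_not_le hnle
      let T' : CanonicalPoint S := ⟨OrderDual.toDual (theoryOf S J), J, hJ, rfl⟩
      have hle : T' ≤ ⟨T, I, hI, h⟩ := by
        change OrderDual.ofDual T ⊆ theoryOf S J
        rw [h]
        refine fun χ hχ => ⟨hχ.1, fun h' => hJnot (J.lower ?_ h')⟩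
        exact inf_le_left.trans (Finset.inf_le (hfin.mem_toFinset.2 hχ))
      have hT' := hforce T' hle ((h₁ hs.1 T').2 ⟨hs.1, fun h' => hJnot (J.lower inf_le_right h')⟩)
      exact ((h₂ hs.2 T').1 hT').2 hψ
    · intro hmem T' hle hT'
      rw [h₁ hs.1] at hT'
      rw [h₂ hs.2]
      have hmem' := hle hmem
      obtain ⟨T', I, hI, h⟩ := T'
      change _ ∈ OrderDual.ofDual T' at hmem'
      rw [h] at hmem' hT' ⊢
      refine ⟨hs.2, fun hψ => (hI.mem_or_mem (x := FreeHA.mk φ ⇨ FreeHA.mk ψ)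
        (y := FreeHA.mk φ) (I.lower himp_inf_le hψ)).elim hmem'.2 hT'.2⟩

/-- The canonical homomorphism from the free Heyting algebra to the algebra of decreasing sets. -/
noncomputable def truthHom (n : ℕ) : HeytingHom (FreeHA n) (Completion n) :=
  (FreeHA.existsUnique_hom fun j => (generic n).truthSet (.var j)).choose

theorem truthHom_gen {n : ℕ} (j : Fin n) :
    truthHom n (FreeHA.gen j) = (generic n).truthSet (.var j) :=
  (FreeHA.existsUnique_hom fun j => (generic n).truthSet (.var j)).choose_spec.1 j

theorem truthHom_mk {n : ℕ} (φ : Formula n) :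
    truthHom n (FreeHA.mk φ) = (generic n).truthSet φ := by
  induction φ with
  | var j => exact truthHom_gen j
  | bot => exact map_bot (truthHom n)
  | and φ ψ h₁ h₂ =>
    refine (map_inf (truthHom n) (FreeHA.mk φ) (FreeHA.mk ψ)).trans ?_
    rw [h₁, h₂]
    rfl
  | or φ ψ h₁ h₂ =>
    refine (map_sup (truthHom n) (FreeHA.mk φ) (FreeHA.mk ψ)).trans ?_
    rw [h₁, h₂]
    rfl
  | imp φ ψ h₁ h₂ =>
    refine (map_himp (truthHom n) (FreeHA.mk φ) (FreeHA.mk ψ)).trans ?_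
    rw [h₁, h₂]
    ext w
    exact Completion.mem_himp

/-- Completeness: the free Heyting algebra embeds into the algebra of decreasing sets. -/
theorem le_of_truthHom_le {n : ℕ} (a b : FreeHA n) (h : truthHom n a ≤ truthHom n b) :
    a ≤ b := by
  obtain ⟨φ, rfl⟩ := FreeHA.mk_surjective a
  obtain ⟨ψ, rfl⟩ := FreeHA.mk_surjective b
  rw [truthHom_mk, truthHom_mk] at h
  by_contra hnle
  obtain ⟨I, hI, hψ, hφ⟩ := exists_isPrime_of_not_le hnle
  obtain ⟨S₁, hS₁, c₁, m₁⟩ := exists_finite_subformulaClosed φ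
  obtain ⟨S₂, hS₂, c₂, m₂⟩ := exists_finite_subformulaClosed ψ
  have hS := hS₁.union hS₂
  have hc := c₁.union c₂
  have := finite_canonicalPoint hS
  let T : CanonicalPoint (S₁ ∪ S₂) := ⟨OrderDual.toDual (theoryOf (S₁ ∪ S₂) I), I, hI, rfl⟩
  obtain ⟨t, ht⟩ := (canonicalModel (S₁ ∪ S₂)).exists_generic_forces_iff T
  have htφ : (generic n).Forces t φ :=
    (ht φ).2 ((forces_canonicalModel hS hc (.inl m₁) T).2 ⟨.inl m₁, hφ⟩)
  exact ((forces_canonicalModel hS hc (.inr m₂) T).1 ((ht ψ).1 (h htφ))).2 hψ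

/-! ### Definability of the points of the generic model -/

theorem Completion.sup_Iic_eq_Iio {n : ℕ} {w : K n} {Y : Finset (K n)}
    (hY : ∀ v, v ∈ Y ↔ v < w) : Y.sup LowerSet.Iic = LowerSet.Iio w := by
  ext u
  rw [SetLike.mem_coe, mem_finset_sup]
  exact ⟨fun ⟨v, hv, hu⟩ => lt_of_le_of_lt hu ((hY v).1 hv),
    fun hu => ⟨u, (hY u).2 hu, LowerSet.mem_Iic_iff.2 le_rfl⟩⟩

/-- The points `u ≤ w` are described by a formula, built from formulae for the points strictly
below `w`: the valuation of `u` contains that of `w`, and every `t ≤ u` that has a further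
variable, or is not above all points strictly below `w`, is itself strictly below `w`. -/
theorem Iic_eq_inf_himp {n : ℕ} (w : K n) {Y : Finset (K n)} (hY : ∀ v, v ∈ Y ↔ v < w) :
    LowerSet.Iic w = ((generic n).val w).inf (fun j => (generic n).truthSet (.var j)) ⊓
      ((((generic n).val w)ᶜ.sup (fun j => (generic n).truthSet (.var j)) ⊔
        Y.sup Completion.notAbove) ⇨ Y.sup LowerSet.Iic) := by
  have hvar : ∀ (u : K n) (j : Fin n),
      u ∈ (generic n).truthSet (.var j) ↔ j ∈ (generic n).val u := fun _ _ => Iff.rfl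
  rw [Completion.sup_Iic_eq_Iio hY]
  ext u
  simp only [SetLike.mem_coe, LowerSet.mem_Iic_iff, LowerSet.mem_Iio_iff, LowerSet.mem_inf_iff, LowerSet.mem_sup_iff,
    Completion.mem_himp, Completion.mem_finset_inf, Completion.mem_finset_sup, hvar,
    Finset.mem_compl, Completion.mem_notAbove, hY]
  constructor
  · intro hu
    refine ⟨fun j hj => (generic n).val_anti hu hj, fun t ht h => ?_⟩
    refine lt_of_le_of_ne (ht.trans hu) ?_
    rintro rfl
    rcases h with ⟨j, hj, hj'⟩ | ⟨v, hv, hv'⟩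
    · exact hj hj'
    · exact hv' hv.le
  · rintro ⟨hval, hu⟩
    suffices h : ∀ t ≤ u, ¬ t < w → t = w by
      by_cases huw : u < w
      · exact huw.le
      · exact (h u le_rfl huw).le
    intro t
    induction t using WellFoundedLT.induction with
    | ind t ih =>
      intro htu htw
      have hnot : (∀ j ∉ (generic n).val w, j ∉ (generic n).val t) ∧ ∀ v < w, v ≤ t :=
        ⟨fun j hj hj' => htw (hu t htu (.inl ⟨j, hj, hj'⟩)),
          fun v hv => by_contra fun hv' => htw (hu t htu (.inr ⟨v, hv, hv'⟩))⟩
      have hteq : (generic n).val t = (generic n).val w := by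
        refine Finset.Subset.antisymm (fun j hj => ?_)
          fun j hj => (generic n).val_anti htu (hval j hj)
        by_contra hjw
        exact hnot.1 j hjw hj
      have hlt : ∀ v, v < w → v < t := fun v hv =>
        lt_of_le_of_ne (hnot.2 v hv) fun e => htw (e ▸ hv)
      by_cases hwt : w < t
      · -- Here `w` would be the only lower cover of `t`, with the same valuation.
        refine absurd hteq (K.val_ne_of_lt_iff_le fun v => ⟨fun hv => ?_, fun hv => ?_⟩)
        · by_cases hvw : v < w
          · exact hvw.le
          · exact (ih v hv (hv.le.trans htu) hvw).le
        · exact lt_of_le_of_lt hv hwt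
      · refine K.eq_of_val_eq hteq fun v => ⟨fun hv => ?_, hlt v⟩
        by_contra hvw
        exact hwt (ih v hv (hv.le.trans htu) hvw ▸ hv)

/-- The points `≤ w`, and the points not `≥ w`, are the truth sets of formulae; both are obtained
by recursion from the formulae of the points strictly below `w`. -/
theorem exists_truthHom_eq_Iic {n : ℕ} (w : K n) :
    ∃ a, truthHom n a = LowerSet.Iic w ∧ ∃ b, truthHom n b = Completion.notAbove w := by
  induction w using WellFoundedLT.induction with
  | ind w ih =>
    choose! x hx y hy using ih
    let Y := (K.finite_Iio w).toFinset
    have hY : ∀ v, v ∈ Y ↔ v < w := fun v => (K.finite_Iio w).mem_toFinset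
    have hsup : truthHom n (Y.sup x) = Y.sup LowerSet.Iic := by
      rw [map_finset_sup]
      exact Finset.sup_congr rfl fun v hv => hx v ((hY v).1 hv)
    have hsup' : truthHom n (Y.sup y) = Y.sup Completion.notAbove := by
      rw [map_finset_sup]
      exact Finset.sup_congr rfl fun v hv => hy v ((hY v).1 hv)
    let a := ((generic n).val w).inf FreeHA.gen ⊓
      ((((generic n).val w)ᶜ.sup FreeHA.gen ⊔ Y.sup y) ⇨ Y.sup x)
    have ha : truthHom n a = LowerSet.Iic w := by
      rw [Iic_eq_inf_himp w hY, map_inf, map_himp, map_sup, hsup, hsup', map_finset_sup,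
        map_finset_inf]
      simp only [Function.comp_def, truthHom_gen]
    refine ⟨a, ha, a ⇨ Y.sup x, ?_⟩
    rw [map_himp, ha, hsup, Completion.sup_Iic_eq_Iio hY, Completion.Iic_himp_Iio]

/-! ### Dense subalgebras -/

/-- A decreasing set `F` within the levels below the `k`-th is isolated: a decreasing set that
agrees with it up to level `k` has no new points on that level, hence none outside it. -/
theorem Completion.eq_of_inter_upTo_eq {n k : ℕ} {A F : Completion n}
    (hF : ∀ u ∈ F, u.1 ∈ level n k)
    (h : (A : Set (K n)) ∩ K.upTo n k = (F : Set (K n)) ∩ K.upTo n k) : A = F := by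
  have key : ∀ u ∈ A, u.1 ∈ level n (k + 1) := by
    intro u hu
    by_contra hcon
    obtain ⟨v, hvu, hv, hvk⟩ := K.exists_le_of_notMem_level u hcon
    exact hvk (hF v (h.subset ⟨A.lower hvu hu, hv⟩).1)
  ext u
  exact ⟨fun hu => (h.subset ⟨hu, key u hu⟩).1,
    fun hu => (h.superset ⟨hu, level_mono_succ n k (hF u hu)⟩).1⟩

/-- A dense set contains all isolated points, hence all decreasing sets of bounded level. -/
theorem Completion.mem_of_dense {n k : ℕ} {s : Set (Completion n)} (hs : Dense s)
    {F : Completion n} (hF : ∀ u ∈ F, u.1 ∈ level n k) : F ∈ s := by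
  obtain ⟨A, hA, hdist⟩ := hs.exists_dist_lt F (show (0 : ℝ) < (1 / 2) ^ k by positivity)
  have hk : k ∉ diffLevels F A := fun hk => absurd hdist (not_lt.2 (le_distance hk))
  rwa [← eq_of_inter_upTo_eq hF (not_not.1 hk).symm]

/-- The inclusion of a Heyting subalgebra. -/
def HeytingSubalgebra.subtype {A : Type*} [HeytingAlgebra A] (H : HeytingSubalgebra A) :
    HeytingHom H A where
  toFun := Subtype.val
  map_sup' _ _ := rfl
  map_inf' _ _ := rfl
  map_bot' := rfl
  map_himp' _ _ := rfl

theorem exists_subtype_eq_Iic {n : ℕ} {H : HeytingSubalgebra (Completion n)}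
    (hH : Dense (H : Set (Completion n))) (w : K n) :
    ∃ a, H.subtype a = LowerSet.Iic w := by
  obtain ⟨k, hk⟩ := w.2
  exact ⟨⟨LowerSet.Iic w, Completion.mem_of_dense hH fun u hu => K.mem_level_of_le hu hk⟩, rfl⟩

end Bellissima

theorem mainTheorem3 (n : ℕ) (hn : 0 < n) :
    -- For dense `H`, and in particular for the free algebra and its completion, the Zariski
    -- topology is the topology of decreasing sets.
    (∀ H : HeytingSubalgebra (Completion n), Dense (H : Set (Completion n)) →
      ∀ U : Set (PrincipalSpec H), IsOpen U ↔ IsLowerSet U) ∧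
    (∀ U : Set (PrincipalSpec (FreeHA n)), IsOpen U ↔ IsLowerSet U) ∧
    (∀ U : Set (PrincipalSpec (Completion n)), IsOpen U ↔ IsLowerSet U) ∧
    -- The natural isomorphisms of posets, and the valuation.
    (∃ (e : K n ≃o PrincipalSpec (FreeHA n)) (e' : K n ≃o PrincipalSpec (Completion n)),
      (∀ (w : K n) (φ : Formula n),
        FreeHA.mk φ ∈ (e w).ideal ↔ w ∉ (generic n).truthSet φ) ∧
      (∀ (w : K n) (X : Completion n), X ∈ (e' w).ideal ↔ w ∉ X) ∧
      (∀ (I : PrincipalSpec (FreeHA n)) (j : Fin n),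
        (j ∈ (generic n).val (e.symm I) ↔ FreeHA.gen j ∉ I.ideal) ∧
        (j ∈ (generic n).val (e.symm I) ↔ I ∈ PrincipalSpec.basicOpen (FreeHA.gen j))) ∧
      (∀ (I : PrincipalSpec (Completion n)) (j : Fin n),
        (j ∈ (generic n).val (e'.symm I) ↔ (generic n).truthSet (.var j) ∉ I.ideal) ∧
        (j ∈ (generic n).val (e'.symm I) ↔
          I ∈ PrincipalSpec.basicOpen ((generic n).truthSet (.var j))))) := by
  have hIic := fun w : K n => (exists_truthHom_eq_Iic w).imp fun _ h => h.1
  have hnot : ∀ w : K n, ∃ b, truthHom n b = Completion.notAbove w := fun w =>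
    let ⟨_, _, h⟩ := exists_truthHom_eq_Iic w
    h
  have hId : ∀ w : K n, ∃ a, HeytingHom.id (Completion n) a = LowerSet.Iic w :=
    fun w => ⟨_, rfl⟩
  have hId' : ∀ a b : Completion n,
      HeytingHom.id (Completion n) a ≤ HeytingHom.id (Completion n) b → a ≤ b := fun _ _ => id
  refine ⟨fun H hH => isOpen_iff_isLowerSet (f := H.subtype) (fun _ _ => id)
      (exists_subtype_eq_Iic hH),
    isOpen_iff_isLowerSet le_of_truthHom_le hIic, isOpen_iff_isLowerSet hId' hId, ?_⟩
  obtain ⟨e, he⟩ := exists_orderIso le_of_truthHom_le hIic hnot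
  obtain ⟨e', he'⟩ := exists_orderIso hId' hId fun w => ⟨Completion.notAbove w, rfl⟩
  have hval : ∀ (I : PrincipalSpec (FreeHA n)) (j : Fin n),
      j ∈ (generic n).val (e.symm I) ↔ FreeHA.gen j ∉ I.ideal := by
    intro I j
    have h := he (e.symm I) (FreeHA.gen j)
    rw [e.apply_symm_apply, truthHom_gen] at h
    rw [h, not_not]
    rfl
  have hval' : ∀ (I : PrincipalSpec (Completion n)) (j : Fin n),
      j ∈ (generic n).val (e'.symm I) ↔ (generic n).truthSet (.var j) ∉ I.ideal := by
    intro I j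
    have h := he' (e'.symm I) ((generic n).truthSet (.var j))
    rw [e'.apply_symm_apply] at h
    rw [h, not_not]
    rfl
  refine ⟨e, e', fun w φ => ?_, he', fun I j => ⟨hval I j, hval I j⟩,
    fun I j => ⟨hval' I j, hval' I j⟩⟩
  rw [he, truthHom_mk]
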